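/- Let $\chi(s)=\dfrac{(2\pi)^s}{2\,\Gamma(s)\cos\frac{\pi s}{2}}$ be the factor in the functional equation $\zeta(s)=\chi(s)\zeta(1-s)$ of the Riemann zeta function. On $\Omega=\mathbf{C}\smallsetminus\bigl((-\infty,0]\cup[1,\infty)\bigr)$ let $\log\chi(s)$ denote the holomorphic branch of the logarithm of $\chi$ with $\log\chi(\tfrac12)=0$, and let \[\vartheta(t)=-\frac{1}{2i}\log\chi(\tfrac12+it)\] be the Riemann–Siegel theta function, which is analytic on $\mathbf{C}$ minus the two cuts $i[\tfrac12,\infty)$ and $-i[\tfrac12,\infty)$. Then for every complex $t$ with $|t|\ge 4$ and $|\Re t|\ge 1$, \[|\vartheta(t)|\le 2|t|\log|t|.\] -/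

import Mathlib

noncomputable section

/-- The factor `χ(s) = (2π)^s / (2 Γ(s) cos(πs/2))` of the functional equation
`ζ(s) = χ(s) ζ(1 - s)`. -/
def zetaChi (s : ℂ) : ℂ :=
  (2 * (Real.pi : ℂ)) ^ s / (2 * Complex.Gamma s * Complex.cos ((Real.pi : ℂ) * s / 2))

/-- The complex plane with the two cuts `(-∞, 0]` and `[1, ∞)` along the real axis. -/
def cutPlane : Set ℂ :=
  {s : ℂ | ¬ (s.im = 0 ∧ (s.re ≤ 0 ∨ 1 ≤ s.re))}

/-- `L` is the holomorphic branch of `log χ` on the cut plane with `log χ(1/2) = 0`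
(its values on the cuts are irrelevant). -/
def IsLogChi (L : ℂ → ℂ) : Prop :=
  DifferentiableOn ℂ L cutPlane ∧ (∀ s ∈ cutPlane, Complex.exp (L s) = zetaChi s) ∧ L (1 / 2) = 0

theorem isOpen_cutPlane : IsOpen cutPlane := by
  have h : IsClosed {s : ℂ | s.im = 0 ∧ (s.re ≤ 0 ∨ 1 ≤ s.re)} :=
    (isClosed_eq Complex.continuous_im continuous_const).inter
      ((isClosed_le Complex.continuous_re continuous_const).union
        (isClosed_le continuous_const Complex.continuous_re))
  exact h.isOpen_compl

theorem half_mem_cutPlane : (1 / 2 : ℂ) ∈ cutPlane := by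
  norm_num [cutPlane]

theorem starConvex_cutPlane : StarConvex ℝ (1 / 2 : ℂ) cutPlane := by
  intro s hs a b ha hb hab h
  apply hs
  obtain ⟨h1, h2⟩ := h
  simp at h1 h2
  rcases h1 with h1 | h1
  · subst h1
    have : a = 1 := by linarith
    subst this
    norm_num at h2
  · refine ⟨h1, ?_⟩
    by_contra! h3
    rcases h2 with h2 | h2
    · have := mul_nonneg hb h3.1.le
      rcases hb.eq_or_lt with rfl | hb
      · have : a = 1 := by linarith
        subst this
        norm_num at h2
      · nlinarith [mul_pos hb h3.1]
    · rcases hb.eq_or_lt with rfl | hb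
      · have : a = 1 := by linarith
        subst this
        norm_num at h2
      · nlinarith [mul_pos hb (sub_pos.2 h3.2)]

theorem ne_neg_nat_of_mem_cutPlane {s : ℂ} (hs : s ∈ cutPlane) (m : ℕ) : s ≠ -m := by
  rintro rfl
  exact hs ⟨by simp, by simp⟩

theorem cos_ne_zero_of_mem_cutPlane {s : ℂ} (hs : s ∈ cutPlane) :
    Complex.cos ((Real.pi : ℂ) * s / 2) ≠ 0 := by
  intro h
  obtain ⟨k, hk⟩ := Complex.cos_eq_zero_iff.1 h
  have hpi : (Real.pi : ℂ) ≠ 0 := Complex.ofReal_ne_zero.2 Real.pi_ne_zero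
  have h1 : s = ((2 * k + 1 : ℤ) : ℂ) := by
    push_cast
    apply mul_left_cancel₀ hpi
    linear_combination 2 * hk
  rw [h1] at hs
  apply hs
  refine ⟨Complex.intCast_im _, ?_⟩
  rw [Complex.intCast_re]
  rcases le_or_gt (2 * k + 1) 0 with h2 | h2
  · exact Or.inl (by exact_mod_cast h2)
  · exact Or.inr (by exact_mod_cast h2)

theorem two_pi_ne_zero_complex : (2 * (Real.pi : ℂ)) ≠ 0 :=
  mul_ne_zero two_ne_zero (Complex.ofReal_ne_zero.2 Real.pi_ne_zero)

theorem zetaChi_ne_zero {s : ℂ} (hs : s ∈ cutPlane) : zetaChi s ≠ 0 := by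
  refine div_ne_zero ?_ (mul_ne_zero (mul_ne_zero two_ne_zero
    (Complex.Gamma_ne_zero (ne_neg_nat_of_mem_cutPlane hs))) (cos_ne_zero_of_mem_cutPlane hs))
  rw [Complex.cpow_def_of_ne_zero two_pi_ne_zero_complex]
  exact Complex.exp_ne_zero _

theorem differentiableAt_zetaChi {s : ℂ} (hs : s ∈ cutPlane) : DifferentiableAt ℂ zetaChi s := by
  refine DifferentiableAt.div ?_ (((Complex.differentiableAt_Gamma s
    (ne_neg_nat_of_mem_cutPlane hs)).const_mul 2).mul ?_) (mul_ne_zero (mul_ne_zero two_ne_zero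
    (Complex.Gamma_ne_zero (ne_neg_nat_of_mem_cutPlane hs))) (cos_ne_zero_of_mem_cutPlane hs))
  · exact differentiableAt_id.const_cpow (Or.inl two_pi_ne_zero_complex)
  · fun_prop

theorem zetaChi_half : zetaChi (1 / 2) = 1 := by
  have h1 : (Real.pi : ℂ) * (1 / 2) / 2 = ((Real.pi / 4 : ℝ) : ℂ) := by push_cast; ring
  have h2 : (2 * (Real.pi : ℂ)) ^ (1 / 2 : ℂ) = ((√2 * √Real.pi : ℝ) : ℂ) := by
    rw [← Real.sqrt_mul (by norm_num), Real.sqrt_eq_rpow,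
      Complex.ofReal_cpow (by positivity)]
    push_cast
    rfl
  have h3 : Complex.Gamma (1 / 2) = ((√Real.pi : ℝ) : ℂ) := by
    rw [← Real.Gamma_one_half_eq, ← Complex.Gamma_ofReal]
    push_cast
    rfl
  have h4 : (√2 : ℝ) ≠ 0 := by positivity
  have h5 : √Real.pi ≠ 0 := (Real.sqrt_pos.2 Real.pi_pos).ne'
  rw [zetaChi, h1, h2, h3, ← Complex.ofReal_cos, Real.cos_pi_div_four]
  have : (√2 * √Real.pi) / (2 * √Real.pi * (√2 / 2)) = 1 := by field_simp
  exact_mod_cast this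

/-- The branch exists. -/
theorem exists_isLogChi : ∃ L : ℂ → ℂ, IsLogChi L := by
  have hsc : IsSimplyConnected cutPlane := by
    have := starConvex_cutPlane.contractibleSpace ⟨_, half_mem_cutPlane⟩
    rw [IsSimplyConnected]
    infer_instance
  obtain ⟨f, hf, hfe⟩ := Complex.exists_continuousOn_eqOn_exp_comp hsc isOpen_cutPlane
    (g := zetaChi) (fun s hs => (differentiableAt_zetaChi hs).continuousAt.continuousWithinAt)
    (by rintro ⟨s, hs, h⟩; exact zetaChi_ne_zero hs h)
  have hd : DifferentiableOn ℂ f cutPlane := by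
    intro s hs
    have hn : cutPlane ∈ nhds s := isOpen_cutPlane.mem_nhds hs
    have hc : Complex.exp ∘ f =ᶠ[nhds s] zetaChi := Filter.eventuallyEq_of_mem hn hfe
    exact (HasDerivAt.of_comp_left (hf.continuousAt hn) (Complex.hasDerivAt_exp _)
      (differentiableAt_zetaChi hs).hasDerivAt (Complex.exp_ne_zero _)
      hc).differentiableAt.differentiableWithinAt
  have h0 : Complex.exp (f (1 / 2)) = 1 := (hfe half_mem_cutPlane).trans zetaChi_half
  refine ⟨fun s => f s - f (1 / 2), hd.sub_const _, fun s hs => ?_, sub_self _⟩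
  rw [Complex.exp_sub, h0, div_one]
  exact hfe hs

/-- The branch is unique on the cut plane. -/
theorem IsLogChi.eqOn {L M : ℂ → ℂ} (hL : IsLogChi L) (hM : IsLogChi M) :
    Set.EqOn L M cutPlane := by
  have hd : ∀ {K : ℂ → ℂ}, IsLogChi K → ∀ s ∈ cutPlane,
      deriv K s = deriv zetaChi s / zetaChi s := by
    intro K hK s hs
    have hn : cutPlane ∈ nhds s := isOpen_cutPlane.mem_nhds hs
    have hc : (fun z => Complex.exp (K z)) =ᶠ[nhds s] zetaChi :=
      Filter.eventuallyEq_of_mem hn hK.2.1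
    have h1 := (hK.1.differentiableAt hn).hasDerivAt.cexp.congr_of_eventuallyEq hc.symm
    rw [h1.deriv, ← hK.2.1 s hs, mul_div_cancel_left₀ _ (Complex.exp_ne_zero _)]
  have hpc : IsPreconnected cutPlane :=
    (starConvex_cutPlane.isPathConnected half_mem_cutPlane).isConnected.isPreconnected
  exact isOpen_cutPlane.eqOn_of_deriv_eq hpc hL.1 hM.1
    (fun s hs => (hd hL s hs).trans (hd hM s hs).symm) half_mem_cutPlane
    (hL.2.2.trans hM.2.2.symm)

/-- The branch of `log χ(s)` on the cut plane that vanishes at `s = 1/2`. -/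
def logChi : ℂ → ℂ := Classical.choose exists_isLogChi

theorem isLogChi_logChi : IsLogChi logChi := Classical.choose_spec exists_isLogChi

/-- The Riemann–Siegel theta function `ϑ(t) = -(1/(2i)) log χ(1/2 + it)`, analytic on the complex
plane minus the cuts `i[1/2, ∞)` and `-i[1/2, ∞)`. -/
def riemannSiegelTheta (t : ℂ) : ℂ :=
  -(1 / (2 * Complex.I)) * logChi (1 / 2 + Complex.I * t)

end

/-!
The functional equation `χ(s) χ(1 - s) = 1` and the reality of `χ` make `ϑ` odd and real, so it
suffices to treat `t` in the fourth quadrant, where `s = 1/2 + it` satisfies `Re s ≥ 1/2` and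
`Im s ≥ 1`. There `2 cos (πs/2) = exp (-πis/2) (1 + exp (πis))` with `exp (πis)` small, so `log χ`
is elementary up to `log Γ`, and Stirling's formula gives
`log χ(s) = (s - 1/2) (1 + log 2π + πi/2 - log s) + O(1)`,
whose modulus is at most `|t| (log |t| + 3) + O(1) ≤ 4 |t| log |t|`.
-/

section

open Complex Filter Topology
open scoped Real ComplexConjugate

/-! ### Stirling's formula in the right half plane -/

/-- The main part `(z - 1/2) log z - z` of Stirling's formula for `log Γ(z)`. -/
noncomputable def stirlingMain (z : ℂ) : ℂ := (z - 1 / 2) * log z - z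

/-- The amount by which `stirlingMain` fails the equation `log Γ(z + 1) = log Γ(z) + log z`. -/
noncomputable def stirlingDefect (z : ℂ) : ℂ := (z + 1 / 2) * (log (z + 1) - log z) - 1

/-- Gudermann's series for the remainder in Stirling's formula for `log Γ(s)`. -/
noncomputable def stirlingRemainder (s : ℂ) : ℂ := ∑' k : ℕ, stirlingDefect (s + k)

/-- The branch of `log Γ` on the right half plane that is real on the real axis, in the form given
by Stirling's formula. -/
noncomputable def logGammaBranch (s : ℂ) : ℂ :=
  stirlingMain s + (Real.log (2 * π) : ℂ) / 2 + stirlingRemainder s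

theorem hasSum_inv_add_nat_sub_inv {x : ℝ} (hx : 0 < x) :
    HasSum (fun k : ℕ => (x + k)⁻¹ - (x + k + 1)⁻¹) x⁻¹ := by
  have hpartial (n : ℕ) : ∑ k ∈ Finset.range n, ((x + k)⁻¹ - (x + k + 1)⁻¹) = x⁻¹ - (x + n)⁻¹ := by
    simpa [add_assoc] using Finset.sum_range_sub' (fun k : ℕ => (x + k)⁻¹) n
  refine (hasSum_iff_tendsto_nat_of_nonneg (fun k => ?_) _).2 ?_
  · exact sub_nonneg.2 (inv_anti₀ (by positivity) (by linarith))
  · have htail : Tendsto (fun n : ℕ => (x + n)⁻¹) atTop (𝓝 0) :=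
      (tendsto_atTop_add_const_left _ x tendsto_natCast_atTop_atTop).inv_tendsto_atTop
    simpa only [hpartial, sub_zero] using htail.const_sub x⁻¹

theorem stirlingMain_add_one_sub (z : ℂ) :
    stirlingMain (z + 1) - stirlingMain z = log z + stirlingDefect z := by
  simp only [stirlingMain, stirlingDefect]
  ring

theorem add_ofReal_mem_slitPlane {z : ℂ} (hz : 0 < z.re) {x : ℝ} (hx : 0 ≤ x) :
    z + x ∈ slitPlane :=
  Or.inl (by simpa using add_pos_of_pos_of_nonneg hz hx)

-- The defect is the integral of `(1/2 - x) / (z + x)`; subtracting `(1/2 - x) / (z + 1/2)`, whose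
-- integral vanishes, produces the square in the numerator.
theorem stirlingDefect_eq_integral {z : ℂ} (hz : 0 < z.re) :
    stirlingDefect z = ∫ x : ℝ in 0..1, (1 / 2 - (x : ℂ)) ^ 2 / ((z + x) * (z + 1 / 2)) := by
  have hhalf : z + 1 / 2 ≠ 0 := ne_zero_of_re_pos (by norm_num; linarith)
  have hhalf' : z * 2 + 1 ≠ 0 := fun h => hhalf (by linear_combination h / 2)
  have hmem : ∀ x ∈ Set.uIcc (0 : ℝ) 1, z + x ∈ slitPlane := fun x hx => by
    rw [Set.uIcc_of_le zero_le_one] at hx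
    exact add_ofReal_mem_slitPlane hz hx.1
  have hderiv : ∀ x ∈ Set.uIcc (0 : ℝ) 1, HasDerivAt
      (fun x : ℝ => (z + 1 / 2) * log (z + x) - x - ((x : ℂ) - x ^ 2) / 2 / (z + 1 / 2))
      ((1 / 2 - (x : ℂ)) ^ 2 / ((z + x) * (z + 1 / 2))) x := fun x hx => by
    have hne : z + x ≠ 0 := slitPlane_ne_zero (hmem x hx)
    have hlog := (((hasDerivAt_id (x : ℂ)).const_add z).clog (hmem x hx)).const_mul (z + 1 / 2)
    have hpoly := (((hasDerivAt_id (x : ℂ)).sub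
      ((hasDerivAt_id (x : ℂ)).pow 2)).div_const 2).div_const (z + 1 / 2)
    refine ((hlog.sub (hasDerivAt_id (x : ℂ))).sub hpoly).comp_ofReal.congr_deriv ?_
    simp only [id_eq]
    field_simp
    ring
  have hint : ContinuousOn (fun x : ℝ => (1 / 2 - (x : ℂ)) ^ 2 / ((z + x) * (z + 1 / 2)))
      (Set.uIcc 0 1) :=
    ContinuousOn.div (by fun_prop) (by fun_prop) fun x hx =>
      mul_ne_zero (slitPlane_ne_zero (hmem x hx)) hhalf
  rw [intervalIntegral.integral_eq_sub_of_hasDerivAt hderiv hint.intervalIntegrable,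
    stirlingDefect]
  push_cast
  ring_nf

theorem norm_stirlingDefect_le {z : ℂ} (hz : 0 < z.re) :
    ‖stirlingDefect z‖ ≤ (z.re⁻¹ - (z.re + 1)⁻¹) / 2 := by
  have hintegrand : ∀ x ∈ Set.uIoc (0 : ℝ) 1,
      ‖(1 / 2 - (x : ℂ)) ^ 2 / ((z + x) * (z + 1 / 2))‖ ≤ 1 / 4 / (z.re * (z.re + 1 / 2)) := by
    intro x hx
    rw [Set.uIoc_of_le zero_le_one] at hx
    have hnum : ‖(1 / 2 - (x : ℂ)) ^ 2‖ ≤ 1 / 4 := by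
      have : (1 / 2 - (x : ℂ)) ^ 2 = (((1 / 2 - x) ^ 2 : ℝ) : ℂ) := by push_cast; ring
      rw [this, norm_real, Real.norm_of_nonneg (sq_nonneg _)]
      nlinarith [hx.1, hx.2]
    have hden : z.re ≤ ‖z + x‖ := by
      refine le_trans ?_ (re_le_norm _)
      simpa using hx.1.le
    have hden' : z.re + 1 / 2 ≤ ‖z + 1 / 2‖ := by
      refine le_trans ?_ (re_le_norm _)
      norm_num
    rw [norm_div, norm_mul]
    gcongr
  rw [stirlingDefect_eq_integral hz]
  calc ‖∫ x : ℝ in 0..1, (1 / 2 - (x : ℂ)) ^ 2 / ((z + x) * (z + 1 / 2))‖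
      ≤ 1 / 4 / (z.re * (z.re + 1 / 2)) := by
        simpa using intervalIntegral.norm_integral_le_of_norm_le_const hintegrand
    _ ≤ 1 / 4 / (z.re * ((z.re + 1) / 2)) := by gcongr; linarith
    _ = (z.re⁻¹ - (z.re + 1)⁻¹) / 2 := by field_simp; ring

theorem norm_stirlingDefect_add_nat_le {x : ℝ} (hx : 0 < x) {s : ℂ} (hs : x ≤ s.re) (k : ℕ) :
    ‖stirlingDefect (s + k)‖ ≤ ((x + k)⁻¹ - (x + k + 1)⁻¹) / 2 := by
  have hpos : 0 < s.re := hx.trans_le hs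
  have hre : (s + k).re = s.re + k := by simp
  have hsub {y : ℝ} (hy : 0 < y) : y⁻¹ - (y + 1)⁻¹ = (y * (y + 1))⁻¹ := by field_simp; ring
  refine (norm_stirlingDefect_le (by rw [hre]; positivity)).trans ?_
  rw [hre, hsub (by positivity), hsub (by positivity)]
  gcongr

theorem hasSum_stirlingRemainder {s : ℂ} (hs : 0 < s.re) :
    HasSum (fun k : ℕ => stirlingDefect (s + k)) (stirlingRemainder s) :=
  (Summable.of_norm_bounded ((hasSum_inv_add_nat_sub_inv hs).div_const 2).summable
    (norm_stirlingDefect_add_nat_le hs le_rfl)).hasSum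

theorem norm_stirlingRemainder_le {s : ℂ} (hs : 0 < s.re) :
    ‖stirlingRemainder s‖ ≤ s.re⁻¹ / 2 :=
  tsum_of_norm_bounded ((hasSum_inv_add_nat_sub_inv hs).div_const 2)
    (norm_stirlingDefect_add_nat_le hs le_rfl)

theorem differentiableAt_stirlingDefect {z : ℂ} (hz : 0 < z.re) :
    DifferentiableAt ℂ stirlingDefect z := by
  have hlog : DifferentiableAt ℂ (fun z => log z) z := differentiableAt_id.clog (Or.inl hz)
  have hlog' : DifferentiableAt ℂ (fun z => log (z + 1)) z :=
    DifferentiableAt.clog (by fun_prop) (Or.inl (by simp; linarith))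
  unfold stirlingDefect
  fun_prop

theorem differentiableAt_stirlingRemainder {s : ℂ} (hs : 0 < s.re) :
    DifferentiableAt ℂ stirlingRemainder s := by
  have hterm (k : ℕ) :
      DifferentiableOn ℂ (fun w : ℂ => stirlingDefect (w + k)) {w | s.re / 2 < w.re} := by
    intro w hw
    have hw : s.re / 2 < w.re := hw
    have hpos : 0 < (w + k).re := by
      rw [add_re, natCast_re]
      linarith [(k.cast_nonneg : (0 : ℝ) ≤ k)]
    exact ((differentiableAt_stirlingDefect hpos).comp w
      (differentiableAt_id.add_const _)).differentiableWithinAt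
  have hsum := differentiableOn_tsum_of_summable_norm
    ((hasSum_inv_add_nat_sub_inv (half_pos hs)).div_const 2).summable hterm (isOpen_re_gt _)
    fun k w hw => norm_stirlingDefect_add_nat_le (half_pos hs) (le_of_lt hw) k
  exact hsum.differentiableAt ((isOpen_re_gt _).mem_nhds (half_lt_self hs))

theorem differentiableAt_logGammaBranch {s : ℂ} (hs : 0 < s.re) :
    DifferentiableAt ℂ logGammaBranch s := by
  have hlog : DifferentiableAt ℂ (fun z => log z) s := differentiableAt_id.clog (Or.inl hs)
  have hrem := differentiableAt_stirlingRemainder hs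
  unfold logGammaBranch stirlingMain
  fun_prop

theorem prod_add_nat_eq_exp {s : ℂ} (hs : 0 < s.re) (n : ℕ) :
    ∏ j ∈ Finset.range n, (s + j) =
      exp (stirlingMain (s + n) - stirlingMain s
        - ∑ j ∈ Finset.range n, stirlingDefect (s + j)) := by
  have htelescope : stirlingMain (s + n) - stirlingMain s =
      ∑ j ∈ Finset.range n, (log (s + j) + stirlingDefect (s + j)) := by
    simp_rw [← stirlingMain_add_one_sub]
    simpa [add_assoc] using (Finset.sum_range_sub (fun j : ℕ => stirlingMain (s + j)) n).symm
  rw [htelescope, Finset.sum_add_distrib, add_sub_cancel_right, exp_sum]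
  refine Finset.prod_congr rfl fun j _ => (exp_log (slitPlane_ne_zero ?_)).symm
  exact_mod_cast add_ofReal_mem_slitPlane hs j.cast_nonneg

theorem tendsto_stirlingMain_natCast_add_sub (w : ℂ) :
    Tendsto (fun n : ℕ => stirlingMain (n + w) - stirlingMain n - w * log n) atTop (𝓝 0) := by
  have hdiv : Tendsto (fun n : ℕ => 1 + w / n) atTop (𝓝 1) := by
    simpa [div_eq_mul_inv] using
      ((tendsto_inv_atTop_nhds_zero_nat (𝕜 := ℂ)).const_mul w).const_add 1
  have hlog : Tendsto (fun n : ℕ => log (1 + w / n)) atTop (𝓝 0) := by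
    simpa using hdiv.clog one_mem_slitPlane
  have hnlog : Tendsto (fun n : ℕ => n * log (1 + w / n)) atTop (𝓝 w) := by
    refine tendsto_nat_mul_log_one_add_of_tendsto (tendsto_const_nhds.congr' ?_)
    filter_upwards [eventually_ne_atTop 0] with n hn
    field_simp
  have hmain := (hnlog.add (hlog.const_mul (w - 1 / 2))).sub_const w
  rw [mul_zero, add_zero, sub_self] at hmain
  refine hmain.congr' ?_
  filter_upwards [eventually_gt_atTop 0, hdiv.eventually_ne one_ne_zero] with n hn hne
  have hlog_add : log (n + w) = log n + log (1 + w / n) := by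
    have hn' : (n : ℂ) ≠ 0 := by exact_mod_cast hn.ne'
    rw [← natCast_log, ← log_ofReal_mul (Nat.cast_pos.2 hn) hne, ofReal_natCast]
    congr 1
    field_simp
  rw [stirlingMain, stirlingMain, hlog_add]
  ring

theorem factorial_eq_stirlingSeq_mul_exp {n : ℕ} (hn : n ≠ 0) :
    (n.factorial : ℂ) = Stirling.stirlingSeq n * √2 * exp (stirlingMain n + log n) := by
  have hn0 : (0 : ℝ) < n := by positivity
  have hpow : √(2 * n) * (n / Real.exp 1) ^ n =
      √2 * Real.exp ((n + 1 / 2) * Real.log n - n) := by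
    have hsqrt : √(n : ℝ) = Real.exp (1 / 2 * Real.log n) := by
      rw [Real.sqrt_eq_rpow, Real.rpow_def_of_pos hn0, mul_comm]
    have hdiv : (n : ℝ) / Real.exp 1 = Real.exp (Real.log n - 1) := by
      rw [Real.exp_sub, Real.exp_log hn0]
    rw [Real.sqrt_mul zero_le_two, hsqrt, hdiv, ← Real.exp_nat_mul, mul_assoc, ← Real.exp_add]
    ring_nf
  have hreal : (n.factorial : ℝ) =
      Stirling.stirlingSeq n * √2 * Real.exp ((n + 1 / 2) * Real.log n - n) := by
    rw [mul_assoc, ← hpow, Stirling.stirlingSeq, div_mul_cancel₀ _ (by positivity)]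
  have hmain : stirlingMain n + log n = (((n + 1 / 2) * Real.log n - n : ℝ) : ℂ) := by
    rw [stirlingMain]
    push_cast [natCast_log]
    ring
  rw [hmain]
  exact_mod_cast hreal

theorem exp_logGammaBranch {s : ℂ} (hs : 0 < s.re) : exp (logGammaBranch s) = Gamma s := by
  have hexponent := ((tendsto_stirlingMain_natCast_add_sub (s + 1)).const_sub
    (stirlingMain s)).add
      ((tendsto_add_atTop_iff_nat 1).2 (hasSum_stirlingRemainder hs).tendsto_sum_nat)
  have hstirling : Tendsto (fun n => (Stirling.stirlingSeq n : ℂ)) atTop (𝓝 (√π : ℝ)) :=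
    (continuous_ofReal.tendsto _).comp Stirling.tendsto_stirlingSeq_sqrt_pi
  have hlim := (hstirling.mul_const (√2 : ℂ)).mul hexponent.cexp
  have hconst : (√π : ℂ) * √2 = exp ((Real.log (2 * π) : ℂ) / 2) := by
    have hreal : √π * √2 = Real.exp (Real.log (2 * π) / 2) := by
      rw [← Real.sqrt_mul Real.pi_pos.le, mul_comm π, Real.exp_half,
        Real.exp_log Real.two_pi_pos]
    exact_mod_cast congrArg ofReal hreal
  have hvalue : (√π : ℂ) * √2 * exp (stirlingMain s - 0 + stirlingRemainder s) =
      exp (logGammaBranch s) := by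
    rw [hconst, ← exp_add, logGammaBranch]
    ring_nf
  rw [← hvalue]
  refine tendsto_nhds_unique (hlim.congr' ?_) (GammaSeq_tendsto_Gamma s)
  filter_upwards [eventually_ne_atTop 0] with n hn
  have hshift : s + (n + 1 : ℕ) = n + (s + 1) := by push_cast; ring
  rw [GammaSeq, prod_add_nat_eq_exp hs, hshift, factorial_eq_stirlingSeq_mul_exp hn,
    cpow_def_of_ne_zero (Nat.cast_ne_zero.2 hn), mul_left_comm, ← exp_add, mul_div_assoc,
    ← exp_sub]
  ring_nf

theorem stirlingDefect_conj {z : ℂ} (hz : 0 < z.re) :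
    stirlingDefect (conj z) = conj (stirlingDefect z) := by
  have hlog := log_conj z (slitPlane_arg_ne_pi (Or.inl hz))
  have hlog' := log_conj (z + 1) (slitPlane_arg_ne_pi (Or.inl (by simp; linarith)))
  rw [map_add, map_one] at hlog'
  simp [stirlingDefect, hlog, hlog', map_ofNat]

theorem logGammaBranch_conj {s : ℂ} (hs : 0 < s.re) :
    logGammaBranch (conj s) = conj (logGammaBranch s) := by
  have hrem : stirlingRemainder (conj s) = conj (stirlingRemainder s) := by
    rw [stirlingRemainder, stirlingRemainder, conj_tsum]
    refine tsum_congr fun k => ?_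
    rw [← stirlingDefect_conj (by rw [add_re, natCast_re]; positivity), map_add, conj_natCast]
  simp [logGammaBranch, stirlingMain, hrem, log_conj s (slitPlane_arg_ne_pi (Or.inl hs)),
    map_ofNat, conj_ofReal]

/-! ### Stirling's formula for `log χ` -/

/-- The region to the right of the imaginary axis with the quadrant `Re s ≥ 1`, `Im s ≤ 0` removed:
on it `1 + exp (πis)` avoids the cut of the principal logarithm. -/
def notchedHalfPlane : Set ℂ := {s | 0 < s.re ∧ (s.re < 1 ∨ 0 < s.im)}

theorem half_mem_notchedHalfPlane : (1 / 2 : ℂ) ∈ notchedHalfPlane := by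
  norm_num [notchedHalfPlane]

theorem notchedHalfPlane_subset_cutPlane : notchedHalfPlane ⊆ cutPlane := by
  rintro s ⟨hre, hre' | him⟩ ⟨him', h | h⟩ <;> linarith

theorem isPreconnected_notchedHalfPlane : IsPreconnected notchedHalfPlane := by
  have hstar : StarConvex ℝ (1 / 2 : ℂ) notchedHalfPlane := by
    rintro s ⟨hre, hs⟩ a b ha hb hab
    have hre_eq : (a • (1 / 2 : ℂ) + b • s).re = a / 2 + b * s.re := by
      simp [div_eq_mul_inv]
    have him_eq : (a • (1 / 2 : ℂ) + b • s).im = b * s.im := by simp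
    rw [notchedHalfPlane, Set.mem_ofPred_eq, hre_eq, him_eq]
    rcases hb.eq_or_lt with rfl | hb
    · norm_num [show a = 1 by linarith]
    · exact ⟨by positivity, hs.imp (fun h => by nlinarith) (mul_pos hb)⟩
  exact (hstar.isPathConnected half_mem_notchedHalfPlane).isConnected.isPreconnected

theorem norm_exp_pi_mul_I (s : ℂ) : ‖exp (π * s * I)‖ = Real.exp (-(π * s.im)) := by
  simp [norm_exp]

theorem one_add_exp_pi_mul_I_mem_slitPlane {s : ℂ} (hs : s ∈ notchedHalfPlane) :
    1 + exp (π * s * I) ∈ slitPlane := by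
  obtain ⟨hre, hre' | him⟩ := hs
  · refine Or.inr (ne_of_gt ?_)
    have hsin : 0 < Real.sin (π * s.re) :=
      Real.sin_pos_of_pos_of_lt_pi (by positivity) (by nlinarith [Real.pi_pos])
    simpa [exp_im] using mul_pos (Real.exp_pos _) hsin
  · refine mem_slitPlane_of_norm_lt_one ?_
    rw [norm_exp_pi_mul_I, Real.exp_lt_one_iff]
    simpa using mul_pos Real.pi_pos him

/-- The branch of `log χ` read off from `2 cos (πs/2) = exp (-πis/2) (1 + exp (πis))`. -/
noncomputable def upperLogChi (s : ℂ) : ℂ :=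
  s * Real.log (2 * π) + π * s / 2 * I - log (1 + exp (π * s * I)) - logGammaBranch s

theorem two_mul_cos_eq (z : ℂ) : 2 * cos z = exp (-(z * I)) * (1 + exp (2 * z * I)) := by
  rw [two_cos, mul_add, mul_one, ← exp_add]
  ring_nf

theorem exp_upperLogChi {s : ℂ} (hs : 0 < s.re) (hne : 1 + exp (π * s * I) ≠ 0) :
    exp (upperLogChi s) = zetaChi s := by
  have hpow : (2 * (π : ℂ)) ^ s = exp (s * Real.log (2 * π)) := by
    rw [cpow_def_of_ne_zero two_pi_ne_zero_complex, mul_comm, ofReal_log Real.two_pi_pos.le]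
    push_cast
    rfl
  have hcos : 2 * cos (π * s / 2) = exp (-(π * s / 2 * I)) * (1 + exp (π * s * I)) := by
    rw [two_mul_cos_eq, mul_div_cancel₀ _ two_ne_zero]
  rw [zetaChi, mul_right_comm, hcos, hpow, upperLogChi, exp_sub, exp_sub, exp_add, exp_log hne,
    exp_logGammaBranch hs, exp_neg]
  field_simp

theorem continuousOn_upperLogChi : ContinuousOn upperLogChi notchedHalfPlane := by
  have hgamma : ContinuousOn logGammaBranch notchedHalfPlane := fun s hs =>
    (differentiableAt_logGammaBranch hs.1).continuousAt.continuousWithinAt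
  have hlog : ContinuousOn (fun s : ℂ => log (1 + exp (π * s * I))) notchedHalfPlane :=
    ContinuousOn.clog (by fun_prop) fun s hs => one_add_exp_pi_mul_I_mem_slitPlane hs
  unfold upperLogChi
  fun_prop

-- As `χ(1/2) = 1` the value is a multiple of `2πi`, and its imaginary part `π/4 - arg (1 + i)` is
-- less than `2π` in absolute value.
theorem upperLogChi_half : upperLogChi (1 / 2) = 0 := by
  have hexp : exp (upperLogChi (1 / 2)) = 1 := by
    rw [exp_upperLogChi (by norm_num) (slitPlane_ne_zero
      (one_add_exp_pi_mul_I_mem_slitPlane half_mem_notchedHalfPlane)), zetaChi_half]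
  have hgamma : (logGammaBranch (1 / 2)).im = 0 := by
    have := logGammaBranch_conj (s := 1 / 2) (by norm_num)
    rw [show conj (1 / 2 : ℂ) = 1 / 2 by simp [map_ofNat]] at this
    exact conj_eq_iff_im.1 this.symm
  have him : (upperLogChi (1 / 2)).im = π / 4 - arg (1 + exp (π * (1 / 2) * I)) := by
    have hlin : (1 / 2 * (Real.log (2 * π) : ℂ) + π * (1 / 2) / 2 * I).im = π / 4 := by
      rw [show 1 / 2 * (Real.log (2 * π) : ℂ) + π * (1 / 2) / 2 * I =
        ((Real.log (2 * π) / 2 : ℝ) : ℂ) + ((π / 4 : ℝ) : ℂ) * I by push_cast; ring]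
      simp
    rw [upperLogChi, sub_im, sub_im, hlin, hgamma, log_im, sub_zero]
  obtain ⟨n, hn⟩ := exp_eq_one_iff.1 hexp
  have him' : (upperLogChi (1 / 2)).im = n * (2 * π) := by
    rw [hn]
    simp
  have harg := abs_le.1 (abs_arg_le_pi (1 + exp (π * (1 / 2) * I)))
  have hlt : (n : ℝ) < 1 := by nlinarith [Real.pi_pos]
  have hgt : (-1 : ℝ) < n := by nlinarith [Real.pi_pos]
  have hzero : n = 0 := by
    have : n < 1 := by exact_mod_cast hlt
    have : -1 < n := by exact_mod_cast hgt
    lia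
  rw [hn, hzero, Int.cast_zero, zero_mul]

theorem eqOn_of_exp_eqOn {X : Type*} [TopologicalSpace X] {S : Set X} (hS : IsPreconnected S)
    {f g : X → ℂ} (hf : ContinuousOn f S) (hg : ContinuousOn g S)
    (hexp : ∀ x ∈ S, exp (f x) = exp (g x)) {a : X} (ha : a ∈ S) (hfg : f a = g a) :
    Set.EqOn f g S :=
  isCoveringMap_exp.eqOn_of_comp_eqOn hS hf hg (fun x hx => Subtype.ext (hexp x hx)) ha hfg

theorem logChi_eqOn_upperLogChi : Set.EqOn logChi upperLogChi notchedHalfPlane := by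
  obtain ⟨hdiff, hexp, hhalf⟩ := isLogChi_logChi
  refine eqOn_of_exp_eqOn isPreconnected_notchedHalfPlane
    (hdiff.continuousOn.mono notchedHalfPlane_subset_cutPlane) continuousOn_upperLogChi
    (fun s hs => ?_) half_mem_notchedHalfPlane (hhalf.trans upperLogChi_half.symm)
  rw [hexp s (notchedHalfPlane_subset_cutPlane hs),
    exp_upperLogChi hs.1 (slitPlane_ne_zero (one_add_exp_pi_mul_I_mem_slitPlane hs))]

theorem logChi_eq_stirling {s : ℂ} (hs : s ∈ notchedHalfPlane) :
    logChi s = (s - 1 / 2) * (((1 + Real.log (2 * π) : ℝ) : ℂ) + (π / 2 : ℝ) * I - log s)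
      + (1 / 2 + (π / 4 : ℝ) * I) - log (1 + exp (π * s * I)) - stirlingRemainder s := by
  rw [logChi_eqOn_upperLogChi hs, upperLogChi, logGammaBranch, stirlingMain]
  push_cast
  ring

/-! ### Symmetries of `log χ` and of `ϑ` -/

theorem one_sub_mem_cutPlane {s : ℂ} (hs : s ∈ cutPlane) : 1 - s ∈ cutPlane := by
  rintro ⟨him, hre⟩
  simp only [sub_im, one_im, zero_sub, neg_eq_zero, sub_re, one_re, sub_nonpos,
    le_sub_self_iff] at him hre
  exact hs ⟨him, hre.symm⟩

theorem conj_mem_cutPlane {s : ℂ} (hs : s ∈ cutPlane) : conj s ∈ cutPlane := by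
  rintro ⟨him, hre⟩
  exact hs ⟨by simpa using him, by simpa using hre⟩

theorem zetaChi_mul_zetaChi_one_sub {s : ℂ} (hs : ∀ k : ℤ, s ≠ k) :
    zetaChi s * zetaChi (1 - s) = 1 := by
  have hpi : (π : ℂ) ≠ 0 := ofReal_ne_zero.2 Real.pi_ne_zero
  have hsin : sin (π * s) ≠ 0 := sin_ne_zero_iff.2 fun k hk =>
    hs k (mul_left_cancel₀ hpi (hk.trans (mul_comm _ _)))
  have hdouble : sin (π * s) = 2 * sin (π * s / 2) * cos (π * s / 2) := by
    rw [← sin_two_mul, mul_div_cancel₀ _ two_ne_zero]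
  have hreflect : cos (π * (1 - s) / 2) = sin (π * s / 2) := by
    rw [← cos_pi_div_two_sub]
    ring_nf
  have hpow : (2 * (π : ℂ)) ^ s * (2 * (π : ℂ)) ^ (1 - s) = 2 * π := by
    rw [← cpow_add _ _ two_pi_ne_zero_complex, add_sub_cancel, cpow_one]
  have hden : 2 * Gamma s * cos (π * s / 2) * (2 * Gamma (1 - s) * sin (π * s / 2)) = 2 * π := by
    calc 2 * Gamma s * cos (π * s / 2) * (2 * Gamma (1 - s) * sin (π * s / 2))
        = 2 * (Gamma s * Gamma (1 - s)) * (2 * sin (π * s / 2) * cos (π * s / 2)) := by ring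
      _ = 2 * π := by
        rw [Gamma_mul_Gamma_one_sub, ← hdouble, mul_assoc, div_mul_cancel₀ _ hsin]
  rw [zetaChi, zetaChi, hreflect, div_mul_div_comm, hpow, hden, div_self two_pi_ne_zero_complex]

theorem zetaChi_conj (s : ℂ) : zetaChi (conj s) = conj (zetaChi s) := by
  have hpow : (2 * (π : ℂ)) ^ conj s = conj ((2 * (π : ℂ)) ^ s) := by
    have harg : (2 * (π : ℂ)).arg ≠ π := by
      have := arg_ofReal_of_nonneg Real.two_pi_pos.le
      push_cast at this
      rw [this]
      exact Real.pi_ne_zero.symm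
    rw [cpow_conj _ _ harg, map_mul, conj_ofReal, map_ofNat]
  have hcos : cos (π * conj s / 2) = conj (cos (π * s / 2)) := by
    rw [← cos_conj, map_div₀, map_mul, conj_ofReal, map_ofNat]
  rw [zetaChi, hpow, hcos, Gamma_conj, zetaChi, map_div₀, map_mul, map_mul, map_ofNat]

theorem ne_intCast_of_mem_cutPlane {s : ℂ} (hs : s ∈ cutPlane) (k : ℤ) : s ≠ k := by
  rintro rfl
  refine hs ⟨intCast_im k, ?_⟩
  rw [intCast_re]
  exact_mod_cast le_or_gt k 0

theorem logChi_one_sub {s : ℂ} (hs : s ∈ cutPlane) : logChi (1 - s) = -logChi s := by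
  obtain ⟨hdiff, hexp, hhalf⟩ := isLogChi_logChi
  have hreflected : IsLogChi fun z => -logChi (1 - z) := by
    refine ⟨(hdiff.comp (by fun_prop) fun z => one_sub_mem_cutPlane).neg, fun z hz => ?_, ?_⟩
    · rw [exp_neg, hexp _ (one_sub_mem_cutPlane hz)]
      exact (eq_inv_of_mul_eq_one_left
        (zetaChi_mul_zetaChi_one_sub (ne_intCast_of_mem_cutPlane hz))).symm
    · beta_reduce
      rw [show (1 - 1 / 2 : ℂ) = 1 / 2 by norm_num, hhalf, neg_zero]
  rw [isLogChi_logChi.eqOn hreflected hs, neg_neg]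

theorem logChi_conj {s : ℂ} (hs : s ∈ cutPlane) : logChi (conj s) = conj (logChi s) := by
  obtain ⟨hdiff, hexp, hhalf⟩ := isLogChi_logChi
  have hconjugated : IsLogChi fun z => conj (logChi (conj z)) := by
    refine ⟨fun z hz => ?_, fun z hz => ?_, ?_⟩
    · have hat := (hdiff.differentiableAt
        (isOpen_cutPlane.mem_nhds (conj_mem_cutPlane hz))).conj_conj
      rw [conj_conj] at hat
      exact hat.differentiableWithinAt
    · rw [exp_conj, hexp _ (conj_mem_cutPlane hz), ← zetaChi_conj, conj_conj]
    · beta_reduce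
      rw [show conj (1 / 2 : ℂ) = 1 / 2 by simp [map_ofNat], hhalf, map_zero]
  rw [isLogChi_logChi.eqOn hconjugated hs, conj_conj]

theorem half_add_I_mul_mem_cutPlane {t : ℂ} (ht : t.re ≠ 0) : 1 / 2 + I * t ∈ cutPlane :=
  fun h => ht (by simpa using h.1)

theorem riemannSiegelTheta_neg {t : ℂ} (ht : t.re ≠ 0) :
    riemannSiegelTheta (-t) = -riemannSiegelTheta t := by
  have hs : 1 / 2 + I * -t = 1 - (1 / 2 + I * t) := by ring
  rw [riemannSiegelTheta, riemannSiegelTheta, hs,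
    logChi_one_sub (half_add_I_mul_mem_cutPlane ht), mul_neg]

theorem riemannSiegelTheta_conj {t : ℂ} (ht : t.re ≠ 0) :
    riemannSiegelTheta (conj t) = conj (riemannSiegelTheta t) := by
  have hcut := half_add_I_mul_mem_cutPlane ht
  have hs : 1 / 2 + I * conj t = 1 - conj (1 / 2 + I * t) := by
    simp only [map_add, map_mul, map_div₀, map_one, map_ofNat, conj_I]
    ring
  rw [riemannSiegelTheta, riemannSiegelTheta, hs, logChi_one_sub (conj_mem_cutPlane hcut),
    logChi_conj hcut]
  simp [map_ofNat]

theorem norm_riemannSiegelTheta (t : ℂ) :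
    ‖riemannSiegelTheta t‖ = ‖logChi (1 / 2 + I * t)‖ / 2 := by
  rw [riemannSiegelTheta, norm_mul, norm_neg, norm_div, norm_mul, norm_I, norm_one,
    RCLike.norm_two]
  ring

/-! ### Growth estimates -/

theorem norm_log_one_add_exp_le {s : ℂ} (hs : 1 ≤ s.im) : ‖log (1 + exp (π * s * I))‖ ≤ 1 := by
  have hsmall : ‖exp (π * s * I)‖ ≤ 1 / 2 := by
    rw [norm_exp_pi_mul_I, Real.exp_neg, one_div]
    refine inv_anti₀ two_pos ?_
    nlinarith [Real.add_one_le_exp (π * s.im), Real.pi_gt_three]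
  linarith [norm_log_one_add_half_le_self hsmall]

theorem norm_add_pi_div_two_mul_I_sub_log_le (c : ℝ) {s : ℂ} (hre : 0 ≤ s.re) (him : 0 ≤ s.im) :
    ‖(c : ℂ) + (π / 2 : ℝ) * I - log s‖ ≤ |c - Real.log ‖s‖| + π / 2 := by
  have harg : |π / 2 - s.arg| ≤ π / 2 := by
    have hnonneg := arg_nonneg_iff.2 him
    have hle := (abs_le.1 (abs_arg_le_pi_div_two_iff.2 hre)).2
    rw [abs_le]
    constructor <;> linarith
  calc ‖(c : ℂ) + (π / 2 : ℝ) * I - log s‖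
      ≤ |c - Real.log ‖s‖| + |π / 2 - s.arg| := by
        simpa [log_re, log_im] using
          norm_le_abs_re_add_abs_im ((c : ℂ) + (π / 2 : ℝ) * I - log s)
    _ ≤ |c - Real.log ‖s‖| + π / 2 := by gcongr

theorem norm_logChi_le {s : ℂ} (hre : 1 / 2 ≤ s.re) (him : 1 ≤ s.im) :
    ‖logChi s‖ ≤ ‖s - 1 / 2‖ * (|1 + Real.log (2 * π) - Real.log ‖s‖| + π / 2) + 7 / 2 := by
  have hconst : ‖(1 / 2 + (π / 4 : ℝ) * I : ℂ)‖ ≤ 3 / 2 := by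
    refine (norm_add_le _ _).trans ?_
    rw [norm_mul, norm_I, norm_real, Real.norm_of_nonneg (by positivity)]
    norm_num
    linarith [Real.pi_lt_four]
  have hrem : ‖stirlingRemainder s‖ ≤ 1 := by
    have hinv : s.re⁻¹ ≤ (1 / 2)⁻¹ := inv_anti₀ (by norm_num) hre
    linarith [norm_stirlingRemainder_le (s := s) (by linarith)]
  have hmain := norm_add_pi_div_two_mul_I_sub_log_le (1 + Real.log (2 * π)) (s := s)
    (by linarith) (by linarith)
  rw [logChi_eq_stirling ⟨by linarith, Or.inr (by linarith)⟩]
  calc _ ≤ ‖s - 1 / 2‖ * (|1 + Real.log (2 * π) - Real.log ‖s‖| + π / 2) + 3 / 2 + 1 + 1 := by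
        refine norm_sub_le_of_le (norm_sub_le_of_le (norm_add_le_of_le ?_ hconst)
          (norm_log_one_add_exp_le him)) hrem
        rw [norm_mul]
        gcongr
    _ = _ := by ring

theorem log_two_pi_mem_Icc : Real.log (2 * π) ∈ Set.Icc 0 2 := by
  refine ⟨Real.log_nonneg (by linarith [Real.pi_gt_three]), ?_⟩
  rw [Real.log_le_iff_le_exp Real.two_pi_pos]
  have hsq : Real.exp 2 = Real.exp 1 * Real.exp 1 := by rw [← Real.exp_add]; norm_num
  nlinarith [Real.exp_one_gt_d9, Real.pi_lt_d2]

theorem norm_sub_half_le_norm {s : ℂ} (hre : 1 / 2 ≤ s.re) : ‖s - 1 / 2‖ ≤ ‖s‖ := by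
  have hre_sub : (s - 1 / 2).re = s.re - 1 / 2 := by simp
  have him_sub : (s - 1 / 2).im = s.im := by simp
  rw [← sq_le_sq₀ (norm_nonneg _) (norm_nonneg _), Complex.sq_norm, Complex.sq_norm,
    normSq_apply, normSq_apply, hre_sub, him_sub]
  nlinarith

theorem abs_one_add_log_two_pi_sub_log_norm_le {s : ℂ} (hre : 1 / 2 ≤ s.re)
    (hs : 4 ≤ ‖s - 1 / 2‖) :
    |1 + Real.log (2 * π) - Real.log ‖s‖| ≤ Real.log ‖s - 1 / 2‖ + 1 := by
  obtain ⟨hpi_nonneg, hpi_le⟩ := log_two_pi_mem_Icc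
  have hpos : 0 < ‖s - 1 / 2‖ := by linarith
  have hlower : Real.log ‖s - 1 / 2‖ ≤ Real.log ‖s‖ :=
    Real.log_le_log hpos (norm_sub_half_le_norm hre)
  have hupper : Real.log ‖s‖ ≤ Real.log 2 + Real.log ‖s - 1 / 2‖ := by
    rw [← Real.log_mul two_ne_zero hpos.ne']
    refine Real.log_le_log (hpos.trans_le (norm_sub_half_le_norm hre)) ?_
    have := norm_add_le (s - 1 / 2) (1 / 2)
    norm_num at this
    linarith
  have hone : 1 ≤ Real.log ‖s - 1 / 2‖ :=
    (Real.le_log_iff_exp_le hpos).2 (by linarith [Real.exp_one_lt_d9])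
  have hlog_two := Real.log_two_lt_d9
  rw [abs_le]
  constructor <;> linarith

theorem norm_riemannSiegelTheta_le_of_im_nonpos {t : ℂ} (ht : 4 ≤ ‖t‖) (hre : 1 ≤ t.re)
    (him : t.im ≤ 0) : ‖riemannSiegelTheta t‖ ≤ 2 * ‖t‖ * Real.log ‖t‖ := by
  set s : ℂ := 1 / 2 + I * t with hs
  have hsre : 1 / 2 ≤ s.re := by norm_num [hs, him]
  have hsim : 1 ≤ s.im := by simpa [hs] using hre
  have hnorm : ‖s - 1 / 2‖ = ‖t‖ := by simp [hs]
  have hlog_lower : 1.38 ≤ Real.log ‖t‖ := by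
    have hfour : Real.log 4 = 2 * Real.log 2 := by
      rw [show (4 : ℝ) = 2 ^ 2 by norm_num, Real.log_pow]
      norm_num
    linarith [Real.log_le_log (by norm_num) ht, Real.log_two_gt_d9]
  have hfactor := abs_one_add_log_two_pi_sub_log_norm_le hsre (hnorm ▸ ht)
  have hchi := norm_logChi_le hsre hsim
  rw [hnorm] at hfactor hchi
  have hbound : ‖logChi s‖ ≤ 4 * ‖t‖ * Real.log ‖t‖ := calc
    ‖logChi s‖ ≤ ‖t‖ * (Real.log ‖t‖ + 1 + 1.6) + 7 / 2 := by
      grw [hchi, hfactor]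
      gcongr
      linarith [Real.pi_lt_d2]
    _ ≤ 4 * ‖t‖ * Real.log ‖t‖ := by nlinarith
  rw [norm_riemannSiegelTheta]
  linarith

end

theorem mainTheorem6 (t : ℂ) (ht : 4 ≤ ‖t‖) (hre : 1 ≤ |t.re|) :
    ‖riemannSiegelTheta t‖ ≤ 2 * ‖t‖ * Real.log ‖t‖ := by
  wlog hpos : 0 ≤ t.re generalizing t
  · have hne : t.re ≠ 0 := fun h => hpos h.ge
    have h := this (-t) (by simpa using ht) (by simpa using hre) (by simpa using (not_le.1 hpos).le)
    rwa [riemannSiegelTheta_neg hne, norm_neg, norm_neg] at h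
  rw [abs_of_nonneg hpos] at hre
  rcases le_total t.im 0 with him | him
  · exact norm_riemannSiegelTheta_le_of_im_nonpos ht hre him
  · have h := norm_riemannSiegelTheta_le_of_im_nonpos (t := starRingEnd ℂ t)
      (by simpa using ht) (by simpa using hre) (by simpa using him)
    rwa [riemannSiegelTheta_conj (by linarith), Complex.norm_conj, Complex.norm_conj] at h
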